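/- Let $P$ be a poset, regarded as a category with a unique morphism $p\to q$ whenever $p\le q$. Let $X$ be the dcpo of filters on $P$ (nonempty, downward directed, upward closed subsets), ordered by inclusion and equipped with the Scott topology. For $p\in P$ let ${\uparrow}p\in X$ be the principal filter and $(p)=\{x\in X : {\uparrow}p\le x\}$; for a sieve $L$ on $p$ let $\widetilde L=\{x\in X : {\uparrow}q\le x \text{ for some } q\in L\}$, an open subset of $X$. Let $\mathcal P(X)$ be the poset of subsets of $X$ and $\mathrm{GT}(P)$ the poset of Grothendieck topologies on $P$, both ordered by inclusion. The strong topology on $X$ is the topology with the locally closed subsets of $X$ as a basis. For $Y\subseteq X$ let $K_Y$ be the Grothendieck topology on $P$ corresponding to the sublocale of $\mathcal O(X)$ given by the frame homomorphism $\mathcal O(X)\to\mathcal O(Y)$, $U\mapsto U\cap Y$ (a sieve $L$ on $p$ covers if and only if $(p)$ and $\widetilde L$ have the same image in $\mathcal O(Y)$). For a Grothendieck topology $J$ on $P$ let $S_J\subseteq X$ be the set of points of the topos $\mathsf{Sh}(P,J)$, where a point, given by its fiber functor $F:P\to\mathsf{Set}$, is identified with the filter $\{p\in P : F(p)\neq\varnothing\}$.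 Then: 1. For every $Y\subseteq X$ and $p\in P$, $K_Y(p)=\{L \text{ a sieve on } p : \widetilde L\supseteq (p)\cap Y\}$. 2. For every $J\in\mathrm{GT}(P)$, $S_J=\{x\in X : \text{for all } p\in P,\ {\uparrow}p\le x \Rightarrow x\in\bigcap_{L\in J(p)}\widetilde L\}$. 3. $K:\mathcal P(X)\to\mathrm{GT}(P)^{\mathrm{op}}$ is left adjoint to $S:\mathrm{GT}(P)^{\mathrm{op}}\to\mathcal P(X)$: for all $Y$ and $J$, $J\subseteq K_Y$ if and only if $Y\subseteq S_J$. 4. $K$ and $S$ restrict to mutually inverse order isomorphisms $\mathcal V(X)\simeq\mathrm{GT}_{\mathrm{ep}}(P)^{\mathrm{op}}$ between the poset $\mathcal V(X)$ of subsets of $X$ that are closed in the strong topology and the opposite of the poset $\mathrm{GT}_{\mathrm{ep}}(P)$ of Grothendieck topologies $J$ such that $\mathsf{Sh}(P,J)$ has enough points. 5. $\mathcal V(X)$ is the image of $S$, and $\mathrm{GT}_{\mathrm{ep}}(P)$ is the image of $K$. 6. A subset of $X$ belongs to $\mathcal V(X)$ if and only if, with the subspace topology, it is a sober space. -/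

import Mathlib

open CategoryTheory TopologicalSpace
open Order (PFilter)
open scoped Topology

universe u v

namespace PosetTopology

/-- The set of filters on `P`, ordered by inclusion, with the Scott topology. -/
instance scottPFilter (P : Type u) [PartialOrder P] : TopologicalSpace (PFilter P) :=
  Topology.scott (PFilter P) Set.univ

instance isScottPFilter (P : Type u) [PartialOrder P] :
    Topology.IsScott (PFilter P) Set.univ := ⟨rfl⟩

/-- The strong topology of a topological space: it is generated by the locally closed subsets
(these are stable under finite intersections, so they form a basis). -/
@[reducible] def strongTopology (X : Type u) [TopologicalSpace X] : TopologicalSpace X :=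
  generateFrom {s : Set X | IsLocallyClosed s}

variable {P : Type u} [PartialOrder P]

theorem isOpen_Ici_principal (p : P) : IsOpen (Set.Ici (PFilter.principal p)) := by
  rw [Topology.IsScott.isOpen_iff_isUpperSet_and_dirSupInaccOn (D := Set.univ)]
  refine ⟨isUpperSet_Ici _, ?_⟩
  intro d _ hne hd x hx hp
  by_contra hcon
  have hno : ∀ y ∈ d, p ∉ y := fun y hy hpy =>
    hcon ⟨y, hy, PFilter.principal_le_iff.2 hpy⟩
  have hfil : Order.IsPFilter (⋃ y ∈ d, (y : Set P)) := by
    refine Order.IsPFilter.of_def ?_ ?_ ?_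
    · obtain ⟨y, hy⟩ := hne
      obtain ⟨a, ha⟩ := y.nonempty
      exact ⟨a, Set.mem_biUnion hy ha⟩
    · intro a ha b hb
      simp only [Set.mem_iUnion] at ha hb
      obtain ⟨y, hy, hay⟩ := ha
      obtain ⟨z, hz, hbz⟩ := hb
      obtain ⟨w, hw, hyw, hzw⟩ := hd y hy z hz
      obtain ⟨c, hc, hca, hcb⟩ := w.directed a (hyw hay) b (hzw hbz)
      exact ⟨c, Set.mem_biUnion hw hc, hca, hcb⟩
    · intro a b hab ha
      simp only [Set.mem_iUnion] at ha ⊢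
      obtain ⟨y, hy, hay⟩ := ha
      exact ⟨y, hy, PFilter.mem_of_le hab hay⟩
  have hle : x ≤ hfil.toPFilter := hx.2 (fun y hy a ha => Set.mem_biUnion hy ha)
  have hmem : p ∈ (⋃ y ∈ d, (y : Set P)) := hle (PFilter.principal_le_iff.1 hp)
  simp only [Set.mem_iUnion] at hmem
  obtain ⟨y, hy, hpy⟩ := hmem
  exact hno y hy hpy

/-- The open set `(p)` of all filters above the principal filter of `p`. -/
def principalOpen (p : P) : Opens (PFilter P) :=
  ⟨Set.Ici (PFilter.principal p), isOpen_Ici_principal p⟩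

/-- The underlying subset of `P` of a sieve on `p`. -/
def sieveSet {p : P} (L : Sieve p) : Set P := {q | ∃ f : q ⟶ p, L f}

/-- The open set generated by a sieve `L`: the upward closure in the poset of filters of the set
of principal filters of elements of `L`. -/
def sieveOpen {p : P} (L : Sieve p) : Opens (PFilter P) where
  carrier := upperClosure (PFilter.principal '' sieveSet L)
  is_open' := by
    rw [coe_upperClosure]
    refine isOpen_biUnion ?_
    rintro _ ⟨q, _, rfl⟩
    exact isOpen_Ici_principal q

theorem mem_principalOpen {p : P} {x : PFilter P} : x ∈ principalOpen p ↔ p ∈ x :=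
  PFilter.principal_le_iff

theorem mem_sieveOpen {p : P} {L : Sieve p} {x : PFilter P} :
    x ∈ sieveOpen L ↔ ∃ q, ∃ f : q ⟶ p, L f ∧ q ∈ x := by
  change x ∈ upperClosure (PFilter.principal '' sieveSet L) ↔ _
  rw [mem_upperClosure]
  constructor
  · rintro ⟨_, ⟨q, ⟨f, hf⟩, rfl⟩, hq⟩
    exact ⟨q, f, hf, PFilter.principal_le_iff.1 hq⟩
  · rintro ⟨q, f, hf, hq⟩
    exact ⟨_, ⟨q, ⟨f, hf⟩, rfl⟩, PFilter.principal_le_iff.2 hq⟩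

/-- The Grothendieck topology on `P` corresponding to a map of locales into the locale of opens
of the space of filters, given by its frame homomorphism `f`: a sieve `L` on `p` covers
if and only if `f` turns the inclusion of the open set generated by `L` into `(p)` into an
equality. -/
def topologyOfFrameHom {F : Type v} [Order.Frame F] (f : FrameHom (Opens (PFilter P)) F) :
    GrothendieckTopology P where
  sieves p := {L | f (principalOpen p) ≤ f (sieveOpen L)}
  top_mem' p := OrderHomClass.mono f fun x hx =>
    mem_sieveOpen.2 ⟨p, 𝟙 p, trivial, mem_principalOpen.1 hx⟩
  pullback_stable' p q S g hS := by
    have h1 : f (principalOpen q) ≤ f (principalOpen p) := OrderHomClass.mono f fun x hx =>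
      mem_principalOpen.2 (PFilter.mem_of_le g.le (mem_principalOpen.1 hx))
    have h2 : f (principalOpen q) ≤ f (sieveOpen S ⊓ principalOpen q) := by
      rw [map_inf]
      exact le_inf (h1.trans hS) le_rfl
    refine h2.trans (OrderHomClass.mono f ?_)
    rintro x ⟨hxS, hxq⟩
    obtain ⟨r, k, hk, hr⟩ := mem_sieveOpen.1 hxS
    obtain ⟨s, hs, hsr, hsq⟩ := x.directed r hr q (mem_principalOpen.1 hxq)
    refine mem_sieveOpen.2 ⟨s, homOfLE hsq, ?_, hs⟩
    change S (homOfLE hsq ≫ g)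
    have := S.downward_closed hk (homOfLE hsr)
    rwa [Subsingleton.elim (homOfLE hsq ≫ g) (homOfLE hsr ≫ k)]
  transitive' p S hS R hR := by
    refine le_trans hS ?_
    have hle : sieveOpen S ≤ ⨆ q : {q : P // ∃ k : q ⟶ p, S k}, principalOpen q.1 := by
      intro x hx
      obtain ⟨q, k, hk, hq⟩ := mem_sieveOpen.1 hx
      exact Opens.mem_iSup.2 ⟨⟨q, k, hk⟩, mem_principalOpen.2 hq⟩
    refine (OrderHomClass.mono f hle).trans ?_
    rw [map_iSup]
    refine iSup_le ?_
    rintro ⟨q, k, hk⟩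
    refine le_trans (hR hk) (OrderHomClass.mono f ?_)
    intro x hx
    obtain ⟨r, l, hl, hr⟩ := mem_sieveOpen.1 hx
    exact mem_sieveOpen.2 ⟨r, l ≫ k, hl, hr⟩

/-- `K_Y`: the Grothendieck topology corresponding to the sublocale of opens of the subspace `Y`,
that is, to the frame homomorphism `U ↦ U ∩ Y`. -/
def K (Y : Set (PFilter P)) : GrothendieckTopology P :=
  topologyOfFrameHom (Opens.comap (⟨Subtype.val, continuous_subtype_val⟩ : C(Y, PFilter P)))

/-- The filter on `P` corresponding to a point of the topos of sheaves on `(P, J)`, such a point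
being given by its fiber functor on `P`: it consists of the elements with nonempty fiber. -/
def pointFilter {J : GrothendieckTopology P} (Φ : GrothendieckTopology.Point.{u} J) :
    PFilter P :=
  Order.IsPFilter.toPFilter (F := {p : P | Nonempty (Φ.fiber.obj p)}) <| by
    refine Order.IsPFilter.of_def ?_ ?_ ?_
    · obtain ⟨⟨p, x⟩⟩ := (IsCofiltered.nonempty : Nonempty Φ.fiber.Elements)
      exact ⟨p, ⟨x⟩⟩
    · rintro p ⟨x⟩ q ⟨y⟩
      let a : Φ.fiber.Elements := ⟨p, x⟩
      let b : Φ.fiber.Elements := ⟨q, y⟩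
      exact ⟨(IsCofiltered.min a b).1, ⟨(IsCofiltered.min a b).2⟩,
        (IsCofiltered.minToLeft a b).1.le, (IsCofiltered.minToRight a b).1.le⟩
    · rintro p q hpq ⟨x⟩
      exact ⟨Φ.fiber.map (homOfLE hpq) x⟩

/-- `S_J`: the set of points of the topos of sheaves on `(P, J)`, as a set of filters. -/
def S (J : GrothendieckTopology P) : Set (PFilter P) :=
  Set.range (pointFilter (J := J))

end PosetTopology

open PosetTopology

/-!
The principal opens `(p)` form a basis of `PFilter P`, so every open subset of `(p)` is generated by
a sieve on `p`. On the other side, the points of `(P, J)` are the filters which meet every covering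
sieve of each of their elements. The Galois connection is then an exchange of quantifiers, and two
computations identify its fixed points.

* Testing `x ∈ S (K Y)` on the complement of `closure {x} = Set.Iic x` shows that `x ∈ S (K Y)` if
  and only if `x` lies in the closure of `Y ∩ closure {x}`, that is, in the strong closure of `Y`.
* `K Y` has enough points because its covering sieves are detected by the points in `Y`; conversely,
  a conservative family of points of `J` lies in `S J` and detects the covering sieves of `J`.

If `x` lies in the strong closure of `Y`, then `Y ∩ closure {x}` is an irreducible closed subset of
`Y` with closure `closure {x}`, so its generic point in a sober `Y` can only be `x`. Conversely, the
generic point in `PFilter P` of an irreducible subset of `Y` lies in the strong closure of `Y`.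
-/

namespace PosetTopology

universe w

open Topology (IsInducing)

section StrongTopology

theorem isTopologicalBasis_isLocallyClosed (X : Type u) [TopologicalSpace X] :
    @IsTopologicalBasis X (strongTopology X) {s : Set X | IsLocallyClosed s} :=
  @isTopologicalBasis_of_subbasis_of_finiteInter _ (strongTopology X) _ rfl
    (FiniteInter.mk isOpen_univ.isLocallyClosed fun _ hs _ ht => hs.inter ht)

variable {X : Type u} [TopologicalSpace X] {Y : Set X} {x : X}

theorem mem_closure_strongTopology_iff :
    x ∈ closure[strongTopology X] Y ↔ x ∈ closure (Y ∩ closure {x}) := by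
  rw [@IsTopologicalBasis.mem_closure_iff _ (strongTopology X) _
    (isTopologicalBasis_isLocallyClosed X), mem_closure_iff]
  constructor
  · intro h U hU hxU
    obtain ⟨y, ⟨hyU, hyx⟩, hyY⟩ :=
      h (U ∩ closure {x}) ⟨U, _, hU, isClosed_closure, rfl⟩ ⟨hxU, subset_closure rfl⟩
    exact ⟨y, hyU, hyY, hyx⟩
  · rintro h _ ⟨U, Z, hU, hZ, rfl⟩ ⟨hxU, hxZ⟩
    obtain ⟨y, hyU, hyY, hyx⟩ := h U hU hxU
    exact ⟨y, ⟨hyU, closure_minimal (Set.singleton_subset_iff.2 hxZ) hZ hyx⟩, hyY⟩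

theorem isIrreducible_of_isIrreducible_image {Z : Type v} [TopologicalSpace Z] {f : X → Z}
    (hf : IsInducing f) (h : IsIrreducible (f '' Y)) : IsIrreducible Y := by
  refine ⟨h.nonempty.of_image, ?_⟩
  rintro U V hU hV ⟨y, hy, hyU⟩ ⟨z, hz, hzV⟩
  obtain ⟨U', hU', rfl⟩ := hf.isOpen_iff.1 hU
  obtain ⟨V', hV', rfl⟩ := hf.isOpen_iff.1 hV
  obtain ⟨_, ⟨w, hw, rfl⟩, hwUV⟩ :=
    h.isPreirreducible U' V' hU' hV' ⟨f y, ⟨y, hy, rfl⟩, hyU⟩ ⟨f z, ⟨z, hz, rfl⟩, hzV⟩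
  exact ⟨w, hw, hwUV⟩

theorem quasiSober_of_isClosed_strongTopology [QuasiSober X]
    (hY : IsClosed[strongTopology X] Y) : QuasiSober Y where
  sober {F} hF hFc := by
    obtain ⟨x, hx⟩ :=
      QuasiSober.sober (hF.image Subtype.val continuous_subtype_val.continuousOn).closure
        isClosed_closure
    have hxY : x ∈ Y := by
      rw [← @IsClosed.closure_eq X (strongTopology X) Y hY, mem_closure_strongTopology_iff, hx.def]
      exact closure_mono (Set.subset_inter (Subtype.coe_image_subset Y F) subset_closure) hx.mem
    refine ⟨⟨x, hxY⟩, ?_⟩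
    rw [isGenericPoint_def, IsInducing.subtypeVal.closure_eq_preimage_closure_image,
      Set.image_singleton, hx.def, ← IsInducing.subtypeVal.closure_eq_preimage_closure_image,
      hFc.closure_eq]

theorem isClosed_strongTopology_of_quasiSober [T0Space X] [QuasiSober Y] :
    IsClosed[strongTopology X] Y := by
  rw [← @closure_subset_iff_isClosed X (strongTopology X) Y]
  intro x hx
  have hclosure : closure (Y ∩ closure {x}) = closure {x} :=
    (closure_minimal Set.inter_subset_right isClosed_closure).antisymm
      (closure_minimal (Set.singleton_subset_iff.2 (mem_closure_strongTopology_iff.1 hx))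
        isClosed_closure)
  have himage : Subtype.val '' (Subtype.val ⁻¹' closure {x} : Set Y) = Y ∩ closure {x} :=
    Subtype.image_preimage_coe Y _
  have hirr : IsIrreducible (Subtype.val ⁻¹' closure {x} : Set Y) := by
    refine isIrreducible_of_isIrreducible_image IsInducing.subtypeVal ?_
    rw [himage, ← isIrreducible_iff_closure, hclosure]
    exact isIrreducible_singleton.closure
  obtain ⟨y, hy⟩ :=
    QuasiSober.sober hirr (isClosed_closure.preimage continuous_subtype_val)
  have hyx : IsGenericPoint y.1 (closure {x}) := by
    simpa only [himage, hclosure] using hy.image continuous_subtype_val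
  rw [← hyx.eq isGenericPoint_closure]
  exact y.2

end StrongTopology

section FilterSpace

variable {P : Type u} [PartialOrder P]

theorem monotone_principalOpen : Monotone (principalOpen (P := P)) :=
  fun _ _ h => Set.Ici_subset_Ici.2 (PFilter.antitone_principal h)

theorem isTopologicalBasis_principalOpen :
    IsTopologicalBasis (Set.range fun p : P => (principalOpen p : Set (PFilter P))) := by
  refine isTopologicalBasis_of_isOpen_of_nhds (Set.forall_mem_range.2 fun p =>
    (principalOpen p).isOpen) fun x U hx hU => ?_
  have hdir : DirectedOn (· ≤ ·) (PFilter.principal '' (x : Set P)) :=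
    x.directed.mono_comp fun _ _ h => PFilter.antitone_principal h
  have hlub : IsLUB (PFilter.principal '' (x : Set P)) x :=
    ⟨Set.forall_mem_image.2 fun _ hp => PFilter.principal_le_iff.2 hp,
      fun y hy p hp => PFilter.principal_le_iff.1 (hy ⟨p, hp, rfl⟩)⟩
  obtain ⟨hupper, hinacc⟩ :=
    (Topology.IsScott.isOpen_iff_isUpperSet_and_dirSupInaccOn (D := Set.univ)).1 hU
  obtain ⟨_, ⟨p, hp, rfl⟩, hpU⟩ :=
    hinacc (Set.mem_univ _) (x.nonempty.image _) hdir hlub hx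
  exact ⟨_, ⟨p, rfl⟩, mem_principalOpen.2 hp, hupper.Ici_subset hpU⟩

theorem isPFilter_setOf_exists_mem {F : Set (PFilter P)} (hF : IsIrreducible F) :
    Order.IsPFilter {p : P | ∃ x ∈ F, p ∈ x} := by
  refine .of_def ?_ ?_ fun hpq ⟨x, hx, hp⟩ => ⟨x, hx, PFilter.mem_of_le hpq hp⟩
  · obtain ⟨x, hx⟩ := hF.nonempty
    obtain ⟨p, hp⟩ := x.nonempty
    exact ⟨p, x, hx, hp⟩
  · rintro p ⟨x, hx, hp⟩ q ⟨y, hy, hq⟩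
    obtain ⟨z, hz, hpz, hqz⟩ := hF.isPreirreducible _ _ (principalOpen p).isOpen
      (principalOpen q).isOpen ⟨x, hx, mem_principalOpen.2 hp⟩ ⟨y, hy, mem_principalOpen.2 hq⟩
    obtain ⟨r, hr, hrp, hrq⟩ :=
      z.directed p (mem_principalOpen.1 hpz) q (mem_principalOpen.1 hqz)
    exact ⟨r, ⟨z, hz, hr⟩, hrp, hrq⟩

instance quasiSober_pFilter : QuasiSober (PFilter P) where
  sober {F} hF hFc := by
    let x := (isPFilter_setOf_exists_mem hF).toPFilter
    have hxF : x ∈ F := by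
      rw [← hFc.closure_eq, isTopologicalBasis_principalOpen.mem_closure_iff]
      rintro _ ⟨p, rfl⟩ hp
      obtain ⟨y, hy, hpy⟩ := mem_principalOpen.1 hp
      exact ⟨y, mem_principalOpen.2 hpy, hy⟩
    refine ⟨x, ?_⟩
    rw [isGenericPoint_def, Topology.IsScott.closure_singleton]
    exact ((Topology.IsScott.isLowerSet_of_isClosed hFc).Iic_subset hxF).antisymm
      fun y hy p hp => ⟨y, hy, hp⟩

end FilterSpace

section Adjunction

variable {P : Type u} [PartialOrder P] {J : GrothendieckTopology P} {Y : Set (PFilter P)}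

theorem mem_K_iff {p : P} {L : Sieve p} :
    L ∈ K Y p ↔ (principalOpen p : Set (PFilter P)) ∩ Y ⊆ sieveOpen L :=
  ⟨fun h y hy => h (show (⟨y, hy.2⟩ : Y) ∈ _ from hy.1), fun h y hy => h ⟨hy, y.2⟩⟩

/-- The sieve on `p` of all `q ≤ p` such that `(q)` is contained in the open set `U`. -/
def sieveOfOpens (p : P) (U : Opens (PFilter P)) : Sieve p where
  arrows q _ := principalOpen q ≤ U
  downward_closed h g := (monotone_principalOpen g.le).trans h

theorem sieveOpen_sieveOfOpens (p : P) (U : Opens (PFilter P)) :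
    sieveOpen (sieveOfOpens p U) = principalOpen p ⊓ U := by
  ext x
  refine mem_sieveOpen.trans ⟨fun ⟨q, f, hqU, hq⟩ => ?_, fun ⟨hp, hU⟩ => ?_⟩
  · exact ⟨mem_principalOpen.2 (PFilter.mem_of_le f.le hq), hqU (mem_principalOpen.2 hq)⟩
  · obtain ⟨_, ⟨q, rfl⟩, hq, hqU⟩ :=
      isTopologicalBasis_principalOpen.exists_subset_of_mem_open hU U.isOpen
    obtain ⟨r, hr, hrp, hrq⟩ := x.directed p (mem_principalOpen.1 hp) q (mem_principalOpen.1 hq)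
    exact ⟨r, homOfLE hrp, (monotone_principalOpen hrq).trans hqU, hr⟩

theorem sieveOfOpens_mem_K_iff {p : P} {U : Opens (PFilter P)} :
    sieveOfOpens p U ∈ K Y p ↔ (principalOpen p : Set (PFilter P)) ∩ Y ⊆ U := by
  rw [mem_K_iff, sieveOpen_sieveOfOpens, Opens.coe_inf, Set.subset_inter_iff,
    and_iff_right Set.inter_subset_left]

instance isCofiltered_pFilter (x : PFilter P) : IsCofiltered x :=
  have : Nonempty x := x.nonempty.to_subtype
  have : IsCodirectedOrder x := x.directed.isCodirectedOrder
  inferInstance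

instance initiallySmall_pFilter (x : PFilter P) : InitiallySmall.{u} x :=
  initiallySmall_of_essentiallySmall x

/-- The point of the topos of sheaves on `(P, J)` given by a filter that meets every covering
sieve of each of its elements, constructed as the cofiltered diagram `x ⥤ P`. -/
noncomputable def pointOfFilter (x : PFilter P) (hx : ∀ p ∈ x, ∀ L ∈ J p, x ∈ sieveOpen L) :
    GrothendieckTopology.Point.{u} J :=
  .ofIsCofiltered (Subtype.mono_coe (· ∈ x)).functor fun p L hL q f => by
    obtain ⟨r, g, hg, hr⟩ := mem_sieveOpen.1 (hx p (PFilter.mem_of_le f.le q.2) L hL)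
    obtain ⟨s, hs, hsq, hsr⟩ := x.directed q q.2 r hr
    exact ⟨r, g, hg, ⟨s, hs⟩, homOfLE hsq, homOfLE hsr, Subsingleton.elim _ _⟩

theorem pointFilter_pointOfFilter (x : PFilter P)
    (hx : ∀ p ∈ x, ∀ L ∈ J p, x ∈ sieveOpen L) : pointFilter (pointOfFilter x hx) = x := by
  ext p
  constructor
  · rintro ⟨a⟩
    obtain ⟨q, f, -⟩ := GrothendieckTopology.Point.ofIsCofiltered.fiberMk_jointly_surjective a
    exact PFilter.mem_of_le f.le q.2
  · intro hp
    exact ⟨GrothendieckTopology.Point.ofIsCofiltered.fiberMk (U := (⟨p, hp⟩ : x)) (𝟙 p)⟩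

theorem mem_S_iff {x : PFilter P} : x ∈ S J ↔ ∀ p ∈ x, ∀ L ∈ J p, x ∈ sieveOpen L := by
  refine ⟨?_, fun hx => ⟨pointOfFilter x hx, pointFilter_pointOfFilter x hx⟩⟩
  rintro ⟨Φ, rfl⟩ p ⟨a⟩ L hL
  obtain ⟨q, f, hf, b, -⟩ := Φ.jointly_surjective L hL a
  exact mem_sieveOpen.2 ⟨q, f, hf, ⟨b⟩⟩

theorem le_K_iff_subset_S : J ≤ K Y ↔ Y ⊆ S J :=
  ⟨fun h _ hy => mem_S_iff.2 fun p hp _ hL => mem_K_iff.1 (h p hL) ⟨mem_principalOpen.2 hp, hy⟩,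
    fun h p L hL => mem_K_iff.2 fun _ ⟨hp, hy⟩ =>
      mem_S_iff.1 (h hy) p (mem_principalOpen.1 hp) L hL⟩

variable (P) in
theorem galoisConnection_K_S : GaloisConnection
    (fun Y : Set (PFilter P) => OrderDual.toDual (K Y))
    (fun J : (GrothendieckTopology P)ᵒᵈ => S (OrderDual.ofDual J)) :=
  fun _ _ => le_K_iff_subset_S

theorem S_K_eq_closure (Y : Set (PFilter P)) :
    S (K Y) = closure[strongTopology (PFilter P)] Y := by
  ext x
  rw [mem_S_iff, mem_closure_strongTopology_iff, Topology.IsScott.closure_singleton,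
    isTopologicalBasis_principalOpen.mem_closure_iff, Set.forall_mem_range]
  constructor
  · intro hx p hp
    by_contra hempty
    have hcover : sieveOfOpens p ⟨(Set.Iic x)ᶜ, isClosed_Iic.isOpen_compl⟩ ∈ K Y p :=
      sieveOfOpens_mem_K_iff.2 fun y ⟨hpy, hy⟩ hyx => hempty ⟨y, hpy, hy, hyx⟩
    have hxU := hx p (mem_principalOpen.1 hp) _ hcover
    rw [sieveOpen_sieveOfOpens] at hxU
    exact hxU.2 (le_refl x)
  · intro hx p hp L hL
    obtain ⟨y, hpy, hy, hyx⟩ := hx p (mem_principalOpen.2 hp)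
    exact (upperClosure _).upper hyx (mem_K_iff.1 hL ⟨hpy, hy⟩)

theorem S_K_eq_iff_isClosed : S (K Y) = Y ↔ IsClosed[strongTopology (PFilter P)] Y := by
  rw [S_K_eq_closure, @closure_eq_iff_isClosed _ (strongTopology _) Y]

end Adjunction

section EnoughPoints

theorem subsingleton_obj_of_isCofiltered_elements {C : Type u} [Category.{v} C] [Quiver.IsThin C]
    (F : C ⥤ Type w) [IsCofilteredOrEmpty F.Elements] (X : C) : Subsingleton (F.obj X) where
  allEq x y := by
    let a : F.Elements := ⟨X, x⟩
    let b : F.Elements := ⟨X, y⟩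
    calc x = F.map (IsCofiltered.minToLeft a b).1 _ := (IsCofiltered.minToLeft a b).2.symm
      _ = F.map (IsCofiltered.minToRight a b).1 _ := by
        rw [Subsingleton.elim (IsCofiltered.minToLeft a b).1]
      _ = y := (IsCofiltered.minToRight a b).2

theorem mem_of_isConservativeFamilyOfPoints {C : Type u} [Category.{v} C] [LocallySmall.{w} C]
    {J : GrothendieckTopology C} [HasSheafify J (Type w)] [J.WEqualsLocallyBijective (Type w)]
    {Q : ObjectProperty (GrothendieckTopology.Point.{w} J)} [ObjectProperty.Small.{w} Q]
    (hQ : Q.IsConservativeFamilyOfPoints) {X : C} {L : Sieve X}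
    (hL : ∀ Φ, Q Φ → ∀ x : Φ.fiber.obj X,
      ∃ (Y : C) (f : Y ⟶ X) (_ : L f) (y : Φ.fiber.obj Y), Φ.fiber.map f y = x) : L ∈ J X := by
  rw [← Sieve.ofArrows_category L, hQ.jointly_reflect_ofArrows_mem_of_small]
  intro Φ x
  obtain ⟨Y, f, hf, y, hy⟩ := hL Φ.obj Φ.property x
  exact ⟨⟨Over.mk f, hf⟩, y, hy⟩

variable {P : Type u} [PartialOrder P] {J : GrothendieckTopology P}

theorem hasEnoughPoints_K (Y : Set (PFilter P)) :
    GrothendieckTopology.HasEnoughPoints.{u} (K Y) := by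
  have hYS : Y ⊆ S (K Y) := le_K_iff_subset_S.1 le_rfl
  choose Φ hΦ using fun y : Y => hYS y.2
  refine ⟨⟨ObjectProperty.ofObj Φ, inferInstance, .mk' fun p L hL => mem_K_iff.2 ?_⟩⟩
  rintro y ⟨hp, hy⟩
  obtain ⟨a⟩ : p ∈ pointFilter (Φ ⟨y, hy⟩) := by rwa [hΦ, ← mem_principalOpen]
  obtain ⟨q, f, hf, b, -⟩ := hL ⟨_, ObjectProperty.ofObj_apply Φ ⟨y, hy⟩⟩ a
  have hq : q ∈ pointFilter (Φ ⟨y, hy⟩) := ⟨b⟩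
  exact mem_sieveOpen.2 ⟨q, f, hf, by rwa [hΦ] at hq⟩

theorem K_S_of_hasEnoughPoints [hJ : GrothendieckTopology.HasEnoughPoints.{u} J] :
    K (S J) = J := by
  obtain ⟨Q, _, hQ⟩ := hJ.exists_objectProperty
  refine le_antisymm (fun p L hL => ?_) (le_K_iff_subset_S.2 le_rfl)
  refine mem_of_isConservativeFamilyOfPoints hQ fun Φ _ a => ?_
  have hΦ : pointFilter Φ ∈ sieveOpen L := mem_K_iff.1 hL ⟨mem_principalOpen.2 ⟨a⟩, Φ, rfl⟩
  obtain ⟨q, f, hf, ⟨b⟩⟩ := mem_sieveOpen.1 hΦ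
  have := subsingleton_obj_of_isCofiltered_elements Φ.fiber p
  exact ⟨q, f, hf, b, Subsingleton.elim _ _⟩

theorem K_S_eq_iff_hasEnoughPoints :
    K (S J) = J ↔ GrothendieckTopology.HasEnoughPoints.{u} J :=
  ⟨fun h => h ▸ hasEnoughPoints_K (S J), fun _ => K_S_of_hasEnoughPoints⟩

theorem range_S : Set.range (S (P := P)) = {Y | IsClosed[strongTopology (PFilter P)] Y} :=
  (Set.range_subset_iff.2 fun J =>
    S_K_eq_iff_isClosed.1 ((galoisConnection_K_S P).u_l_u_eq_u (OrderDual.toDual J))).antisymm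
      fun Y hY => ⟨K Y, S_K_eq_iff_isClosed.2 hY⟩

theorem range_K : Set.range (K (P := P)) = {J | GrothendieckTopology.HasEnoughPoints.{u} J} :=
  (Set.range_subset_iff.2 hasEnoughPoints_K).antisymm
    fun J hJ => ⟨S J, K_S_eq_iff_hasEnoughPoints.2 hJ⟩

variable (P) in
/-- The mutually inverse order isomorphisms to which `K` and `S` restrict, between the strongly
closed sets of filters and the Grothendieck topologies with enough points, ordered oppositely. -/
def stronglyClosedOrderIso :
    {Y : Set (PFilter P) // IsClosed[strongTopology (PFilter P)] Y} ≃o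
      {J : GrothendieckTopology P // GrothendieckTopology.HasEnoughPoints.{u} J}ᵒᵈ where
  toFun Y := OrderDual.toDual ⟨K Y.1, hasEnoughPoints_K Y.1⟩
  invFun J := ⟨S (OrderDual.ofDual J).1, range_S.subset ⟨_, rfl⟩⟩
  left_inv Y := Subtype.ext (S_K_eq_iff_isClosed.2 Y.2)
  right_inv J := Subtype.ext (K_S_eq_iff_hasEnoughPoints.2 (OrderDual.ofDual J).2)
  map_rel_iff' {Y Z} := by
    change K Z.1 ≤ K Y.1 ↔ Y.1 ⊆ Z.1
    rw [le_K_iff_subset_S, S_K_eq_iff_isClosed.2 Z.2]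

end EnoughPoints

end PosetTopology

theorem mainTheorem1 (P : Type u) [PartialOrder P] :
    -- explicit formulas for `K` and `S`
    (∀ (Y : Set (PFilter P)) (p : P) (L : Sieve p),
      L ∈ K Y p ↔ Set.Ici (PFilter.principal p) ∩ Y ⊆
        (upperClosure (PFilter.principal '' {q : P | ∃ f : q ⟶ p, L f}) : Set (PFilter P))) ∧
    (∀ J : GrothendieckTopology P,
      S J = {x : PFilter P | ∀ p : P, PFilter.principal p ≤ x → ∀ L ∈ J p,
        x ∈ upperClosure (PFilter.principal '' {q : P | ∃ f : q ⟶ p, L f})}) ∧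
    -- `K` is left adjoint to `S`
    GaloisConnection
      (fun Y : Set (PFilter P) => OrderDual.toDual (K Y))
      (fun J : (GrothendieckTopology P)ᵒᵈ => S (OrderDual.ofDual J)) ∧
    -- the adjunction restricts to an order isomorphism
    (∃ e : {Y : Set (PFilter P) // IsClosed[strongTopology (PFilter P)] Y} ≃o
        {J : GrothendieckTopology P // GrothendieckTopology.HasEnoughPoints.{u} J}ᵒᵈ,
      (∀ Y, (OrderDual.ofDual (e Y)).1 = K Y.1) ∧
      (∀ J, (e.symm J).1 = S (OrderDual.ofDual J).1)) ∧
    -- the images of `S` and `K`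
    Set.range (fun J : GrothendieckTopology P => S J) =
      {Y | IsClosed[strongTopology (PFilter P)] Y} ∧
    Set.range (fun Y : Set (PFilter P) => K Y) =
      {J | GrothendieckTopology.HasEnoughPoints.{u} J} ∧
    -- the subsets closed in the strong topology are the sober subspaces
    (∀ Y : Set (PFilter P),
      IsClosed[strongTopology (PFilter P)] Y ↔ (QuasiSober Y ∧ T0Space Y)) := by
  refine ⟨fun _ _ _ => mem_K_iff, fun J => ?_, galoisConnection_K_S P,
    ⟨stronglyClosedOrderIso P, fun _ => rfl, fun _ => rfl⟩, range_S, range_K, fun Y => ?_⟩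
  · ext x
    simp only [mem_S_iff, PFilter.principal_le_iff]
    rfl
  · exact ⟨fun hY => ⟨quasiSober_of_isClosed_strongTopology hY, inferInstance⟩,
      fun ⟨_, _⟩ => isClosed_strongTopology_of_quasiSober⟩
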